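/- For a complex-valued $2\pi$-periodic function $f$ on $\mathbb{R}$, integrable over a period, let $\|f\|_1=\int_{-\pi}^{\pi}|f(x)|\,dx$, $\hat f(k)=\frac1{2\pi}\int_{-\pi}^{\pi}f(x)e^{-ikx}\,dx$ for $k\in\mathbb{Z}$, and $S_n(f)(x)=\sum_{k=-n}^{n}\hat f(k)e^{ikx}$. A complex sequence $\{c_n\}$ belongs to the class GBV if (i) there is $\theta\in[0,\pi/2)$ such that $c_n\in\{z\in\mathbb{C}:|\arg z|\le\theta\}\cup\{0\}$ for all $n\ge1$, and (ii) there are an integer $N_0\ge1$ and a constant $M>0$ such that $$\sum_{n=m}^{2m}|c_n-c_{n+1}|\le M\max_{m\le n<m+N_0}|c_n|\qquad\text{for all } m=1,2,\dots$$ (no condition is imposed on $c_0$). **Corollary 2.** Let $f$ be a real-valued $2\pi$-periodic function, integrable over a period, such that $\{\hat f(n)\}_{n\ge0}$ belongs to GBV. Then $$\lim_{n\to\infty}\|f-S_n(f)\|_1=0\quad\text{if and only if}\quad\lim_{n\to\infty}\hat f(n)\log|n|=0,$$ and this holds both when the second limit is taken as $n\to+\infty$ and when it is taken as $|n|\to\infty$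 over $n\in\mathbb{Z}$. -/

import Mathlib

noncomputable section

/-- `f` is a complex valued function of period `2π` that is integrable over a period. -/
def MemL2pi (f : ℝ → ℂ) : Prop :=
  Function.Periodic f (2 * Real.pi) ∧
    IntervalIntegrable f MeasureTheory.volume (-Real.pi) Real.pi

/-- The norm `∫_{-π}^{π} |f(x)| dx`. -/
def l1Norm (f : ℝ → ℂ) : ℝ :=
  ∫ x in (-Real.pi)..Real.pi, ‖f x‖

/-- The Fourier coefficient `(1 / 2π) ∫_{-π}^{π} f(x) e^{-ikx} dx`. -/
def fourierHat (f : ℝ → ℂ) (k : ℤ) : ℂ :=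
  fourierCoeffOn (neg_lt_self Real.pi_pos) f k

/-- The `n`th symmetric partial sum of the Fourier series of `f`. -/
def fourierPartialSum (f : ℝ → ℂ) (n : ℕ) (x : ℝ) : ℂ :=
  ∑ k ∈ Finset.Icc (-(n : ℤ)) (n : ℤ), fourierHat f k * Complex.exp (Complex.I * k * x)

/-- The sector `{z : |arg z| ≤ θ}`; since `Complex.arg 0 = 0` it contains `0` for `0 ≤ θ`. -/
def sector (θ : ℝ) : Set ℂ :=
  {z | |Complex.arg z| ≤ θ}

/-- The class GBV. Only the terms `c n` with `1 ≤ n` are constrained. -/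
def IsGBV (c : ℕ → ℂ) : Prop :=
  (∃ θ : ℝ, 0 ≤ θ ∧ θ < Real.pi / 2 ∧ ∀ n : ℕ, 1 ≤ n → c n ∈ sector θ) ∧
  ∃ (N : ℕ) (hN : 1 ≤ N) (M : ℝ), 0 < M ∧ ∀ m : ℕ, 1 ≤ m →
    ∑ n ∈ Finset.Icc m (2 * m), ‖c n - c (n + 1)‖ ≤
      M * (Finset.Ico m (m + N)).sup' (Finset.nonempty_Ico.mpr (Nat.lt_add_of_pos_right hN))
        (fun n => ‖c n‖)

end

open Real MeasureTheory intervalIntegral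

/-! Write c_n for the n-th coefficient.

Sufficiency compares S_n with the delayed mean of S_l over n ≤ l < 2n. These means converge to f in
L¹ for every integrable f, because sums of partial sums are convolutions with a nonnegative Fejér
kernel and trigonometric polynomials are dense (`eventually_l1Norm_sub_delayed_mean_le`). Since f is
real, S_l - S_n is a block of the power series in e^{ix} plus its conjugate. Abel summation bounds
its L¹ norm by log n times the variation of c on the block (`l1Norm_fourierPartialSum_sub_le`), and
GBV bounds that variation by a single |c_i| with i ≥ n.

Necessity tests f - S_n against e^{-int} ∑ sin(jt)/j, which is bounded uniformly in n. Only
frequencies above n survive, leaving ∑ c_{n+j}/j. The sector condition rules out cancellation, so ∑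
|c_{n+j}|/j tends to 0 (`cos_mul_sum_norm_div_le`). By GBV, |c_p| is at most a constant times a sum
of |c| over any window of N terms starting between about p/2 and p; averaging with weights 1/j
produces log p (`IsGBV.exists_norm_mul_log_le`). -/

/-! ### Fourier coefficients and partial sums. -/

theorem fourierHat_eq_integral (f : ℝ → ℂ) (k : ℤ) :
    fourierHat f k =
      (2 * π : ℂ)⁻¹ * ∫ t in (-π)..π, f t * Complex.exp (-(Complex.I * k * t)) := by
  rw [fourierHat, fourierCoeffOn_eq_integral, Complex.real_smul]
  congr 1
  · push_cast
    rw [one_div]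
    congr 1
    ring
  · refine integral_congr fun t _ => ?_
    have hπ : (π : ℂ) ≠ 0 := by exact_mod_cast pi_ne_zero
    simp only [fourier_coe_apply, smul_eq_mul]
    rw [mul_comm]
    congr 2
    push_cast
    field_simp
    ring

theorem continuous_exp_I_mul (k : ℤ) : Continuous fun x : ℝ => Complex.exp (Complex.I * k * x) := by
  fun_prop

theorem integral_exp_I_mul (k : ℤ) :
    ∫ x in (-π)..π, Complex.exp (Complex.I * k * x) = if k = 0 then (2 * π : ℂ) else 0 := by
  split_ifs with hk
  · subst hk
    simp
    ring
  · have hc : Complex.I * k ≠ 0 := mul_ne_zero Complex.I_ne_zero (by exact_mod_cast hk)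
    rw [integral_exp_mul_complex hc, div_eq_zero_iff]
    left
    rw [sub_eq_zero, Complex.exp_eq_exp_iff_exists_int]
    exact ⟨k, by push_cast; ring⟩

theorem fourierHat_exp (j k : ℤ) :
    fourierHat (fun x => Complex.exp (Complex.I * j * x)) k = if k = j then 1 else 0 := by
  rw [fourierHat_eq_integral]
  have h : ∀ t : ℝ, Complex.exp (Complex.I * j * t) * Complex.exp (-(Complex.I * k * t)) =
      Complex.exp (Complex.I * (j - k : ℤ) * t) := by
    intro t
    rw [← Complex.exp_add]
    push_cast
    ring_nf
  simp_rw [h, integral_exp_I_mul, sub_eq_zero, eq_comm (a := j)]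
  have hπ : (2 * π : ℂ) ≠ 0 := by exact_mod_cast two_pi_pos.ne'
  split_ifs
  · exact inv_mul_cancel₀ hπ
  · simp

theorem intervalIntegrable_mul_exp {f : ℝ → ℂ} (hf : IntervalIntegrable f volume (-π) π) (k : ℤ) :
    IntervalIntegrable (fun t => f t * Complex.exp (-(Complex.I * k * t))) volume (-π) π :=
  hf.mul_continuousOn (by fun_prop)

theorem fourierHat_sub {f g : ℝ → ℂ} (hf : IntervalIntegrable f volume (-π) π)
    (hg : IntervalIntegrable g volume (-π) π) (k : ℤ) :
    fourierHat (fun x => f x - g x) k = fourierHat f k - fourierHat g k := by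
  simp only [fourierHat_eq_integral, sub_mul]
  rw [integral_sub (intervalIntegrable_mul_exp hf k) (intervalIntegrable_mul_exp hg k), mul_sub]

theorem fourierHat_add {f g : ℝ → ℂ} (hf : IntervalIntegrable f volume (-π) π)
    (hg : IntervalIntegrable g volume (-π) π) (k : ℤ) :
    fourierHat (fun x => f x + g x) k = fourierHat f k + fourierHat g k := by
  simp only [fourierHat_eq_integral, add_mul]
  rw [integral_add (intervalIntegrable_mul_exp hf k) (intervalIntegrable_mul_exp hg k), mul_add]

theorem fourierHat_const_mul (c : ℂ) (f : ℝ → ℂ) (k : ℤ) :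
    fourierHat (fun x => c * f x) k = c * fourierHat f k :=
  fourierCoeffOn.const_mul _ _ _ _

theorem fourierHat_ofReal_neg (f : ℝ → ℝ) (k : ℤ) :
    fourierHat (fun x => (f x : ℂ)) (-k) =
      (starRingEnd ℂ) (fourierHat (fun x => (f x : ℂ)) k) := by
  simp only [fourierHat_eq_integral, map_mul, map_inv₀, ← intervalIntegral.intervalIntegral_conj]
  simp [← Complex.exp_conj, Complex.conj_ofNat]

theorem continuous_fourierPartialSum (f : ℝ → ℂ) (n : ℕ) :
    Continuous (fourierPartialSum f n) := by
  unfold fourierPartialSum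
  fun_prop

theorem fourierPartialSum_sub {f g : ℝ → ℂ} (hf : IntervalIntegrable f volume (-π) π)
    (hg : IntervalIntegrable g volume (-π) π) (n : ℕ) (x : ℝ) :
    fourierPartialSum (fun x => f x - g x) n x =
      fourierPartialSum f n x - fourierPartialSum g n x := by
  simp only [fourierPartialSum, fourierHat_sub hf hg, sub_mul, Finset.sum_sub_distrib]

theorem fourierHat_fourierPartialSum (f : ℝ → ℂ) (n : ℕ) (k : ℤ) :
    fourierHat (fourierPartialSum f n) k =
      if k ∈ Finset.Icc (-(n : ℤ)) n then fourierHat f k else 0 := by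
  have key : ∀ s : Finset ℤ, fourierHat
      (fun x : ℝ => ∑ j ∈ s, fourierHat f j * Complex.exp (Complex.I * j * x)) k =
      ∑ j ∈ s, if k = j then fourierHat f j else 0 := by
    intro s
    induction s using Finset.induction_on with
    | empty => simp [fourierHat_eq_integral]
    | insert a s ha ih =>
      simp only [Finset.sum_insert ha]
      rw [fourierHat_add, ih, fourierHat_const_mul, fourierHat_exp]
      · simp
      · exact Continuous.intervalIntegrable (by fun_prop) _ _
      · exact Continuous.intervalIntegrable (by fun_prop) _ _
  have := key (Finset.Icc (-(n : ℤ)) n)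
  rw [Finset.sum_ite_eq] at this
  exact this

/-! ### Dirichlet and Fejér kernels. -/

/-- The Dirichlet kernel. -/
noncomputable def dirichletKernel (n : ℕ) (x : ℝ) : ℂ :=
  ∑ k ∈ Finset.Icc (-(n : ℤ)) (n : ℤ), Complex.exp (Complex.I * k * x)

theorem fourierPartialSum_eq_integral {f : ℝ → ℂ} (hf : IntervalIntegrable f volume (-π) π)
    (n : ℕ) (x : ℝ) :
    fourierPartialSum f n x =
      (2 * π : ℂ)⁻¹ * ∫ t in (-π)..π, f t * dirichletKernel n (x - t) := by
  simp only [fourierPartialSum, dirichletKernel, fourierHat_eq_integral, Finset.mul_sum]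
  rw [intervalIntegral.integral_finsetSum, Finset.mul_sum]
  · refine Finset.sum_congr rfl fun k _ => ?_
    rw [mul_assoc, ← intervalIntegral.integral_mul_const]
    congr 1
    refine integral_congr fun t _ => ?_
    simp only [mul_assoc, ← Complex.exp_add]
    push_cast
    ring_nf
  · intro k _
    exact hf.mul_continuousOn (by fun_prop)

theorem sum_Icc_neg_succ {M : Type*} [AddCommMonoid M] (g : ℤ → M) (n : ℕ) :
    ∑ k ∈ Finset.Icc (-((n + 1 : ℕ) : ℤ)) ((n + 1 : ℕ) : ℤ), g k =
      ∑ k ∈ Finset.Icc (-(n : ℤ)) (n : ℤ), g k + (g (n + 1) + g (-(n + 1))) := by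
  have h : Finset.Icc (-((n + 1 : ℕ) : ℤ)) ((n + 1 : ℕ) : ℤ) =
      insert ((n : ℤ) + 1) (insert (-((n : ℤ) + 1)) (Finset.Icc (-(n : ℤ)) n)) := by
    ext k
    simp only [Finset.mem_Icc, Finset.mem_insert]
    omega
  rw [h, Finset.sum_insert, Finset.sum_insert, ← add_assoc, add_comm]
  · simp only [Finset.mem_Icc]
    omega
  · simp only [Finset.mem_Icc, Finset.mem_insert]
    omega

/-- The unnormalised Fejér kernel is the square of the modulus of a geometric sum. -/
theorem sum_dirichletKernel (N : ℕ) (x : ℝ) :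
    ∑ l ∈ Finset.range N, dirichletKernel l x =
      ((‖∑ j ∈ Finset.range N, Complex.exp (Complex.I * x) ^ j‖ ^ 2 : ℝ) : ℂ) := by
  set z := Complex.exp (Complex.I * x) with hz
  set w := Complex.exp (-(Complex.I * x)) with hw
  have hzw : z * w = 1 := by rw [hz, hw, ← Complex.exp_add]; simp
  have hconj : (starRingEnd ℂ) z = w := by rw [hz, ← Complex.exp_conj]; simp [hw]
  -- As z^j w^N = w^(N-j), the two sums carry the negative and the positive frequencies. This
  -- expression is also the increment of the squared modulus from N to N + 1, which drives the final
  -- induction.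
  have hD : ∀ N : ℕ, dirichletKernel N x =
      (∑ j ∈ Finset.range N, z ^ j) * w ^ N + (∑ j ∈ Finset.range N, w ^ j) * z ^ N + 1 := by
    intro N
    induction N with
    | zero => simp [dirichletKernel]
    | succ N ih =>
      have h1 : Complex.exp (Complex.I * ((N : ℤ) + 1 : ℤ) * x) = z ^ (N + 1) := by
        rw [hz, ← Complex.exp_nat_mul]; push_cast; ring_nf
      have h2 : Complex.exp (Complex.I * (-((N : ℤ) + 1) : ℤ) * x) = w ^ (N + 1) := by
        rw [hw, ← Complex.exp_nat_mul]; push_cast; ring_nf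
      rw [dirichletKernel, sum_Icc_neg_succ, h1, h2, ← dirichletKernel, ih, geom_sum_succ,
        geom_sum_succ]
      linear_combination (-((∑ j ∈ Finset.range N, z ^ j) * w ^ N +
        (∑ j ∈ Finset.range N, w ^ j) * z ^ N)) * hzw
  push_cast
  rw [← Complex.mul_conj', map_sum]
  simp_rw [map_pow, hconj]
  induction N with
  | zero => simp
  | succ N ih =>
    have h1 : z ^ N * w ^ N = 1 := by rw [← mul_pow, hzw, one_pow]
    rw [Finset.sum_range_succ, ih, hD, Finset.sum_range_succ, Finset.sum_range_succ]
    linear_combination -h1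

theorem continuous_dirichletKernel (n : ℕ) : Continuous (dirichletKernel n) := by
  unfold dirichletKernel
  fun_prop

theorem integral_dirichletKernel (n : ℕ) : ∫ x in (-π)..π, dirichletKernel n x = 2 * π := by
  unfold dirichletKernel
  rw [intervalIntegral.integral_finsetSum]
  · simp_rw [integral_exp_I_mul]
    rw [Finset.sum_ite_eq']
    simp
  · intro k _
    exact (continuous_exp_I_mul k).intervalIntegrable _ _

theorem periodic_dirichletKernel (n : ℕ) : Function.Periodic (dirichletKernel n) (2 * π) := by
  intro x
  unfold dirichletKernel
  refine Finset.sum_congr rfl fun k _ => ?_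
  rw [Complex.exp_eq_exp_iff_exists_int]
  exact ⟨k, by push_cast; ring⟩

/-- The unnormalised Fejér kernel. -/
noncomputable def fejerKernel (N : ℕ) (x : ℝ) : ℝ :=
  ‖∑ j ∈ Finset.range N, Complex.exp (Complex.I * x) ^ j‖ ^ 2

theorem ofReal_fejerKernel (N : ℕ) (x : ℝ) :
    (fejerKernel N x : ℂ) = ∑ l ∈ Finset.range N, dirichletKernel l x :=
  (sum_dirichletKernel N x).symm

theorem fejerKernel_nonneg (N : ℕ) (x : ℝ) : 0 ≤ fejerKernel N x := by
  unfold fejerKernel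
  positivity

theorem continuous_fejerKernel (N : ℕ) : Continuous (fejerKernel N) := by
  unfold fejerKernel
  fun_prop

theorem periodic_fejerKernel (N : ℕ) : Function.Periodic (fejerKernel N) (2 * π) := by
  intro x
  have : ((fejerKernel N (x + 2 * π) : ℝ) : ℂ) = fejerKernel N x := by
    simp only [ofReal_fejerKernel]
    exact Finset.sum_congr rfl fun l _ => periodic_dirichletKernel l x
  exact_mod_cast this

theorem integral_fejerKernel_sub (N : ℕ) (t : ℝ) :
    ∫ x in (-π)..π, fejerKernel N (x - t) = N * (2 * π) := by
  rw [intervalIntegral.integral_comp_sub_right]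
  have h := (periodic_fejerKernel N).intervalIntegral_add_eq (-π - t) (-π)
  rw [show -π - t + 2 * π = π - t by ring, show -π + 2 * π = π by ring] at h
  rw [h]
  have : ((∫ x in (-π)..π, fejerKernel N x : ℝ) : ℂ) = N * (2 * π) := by
    rw [← intervalIntegral.integral_ofReal]
    simp only [ofReal_fejerKernel]
    rw [intervalIntegral.integral_finsetSum
      fun l _ => (continuous_dirichletKernel l).intervalIntegrable _ _]
    simp [integral_dirichletKernel]
  exact_mod_cast this

theorem sum_fourierPartialSum_eq_integral {f : ℝ → ℂ} (hf : IntervalIntegrable f volume (-π) π)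
    (N : ℕ) (x : ℝ) :
    ∑ l ∈ Finset.range N, fourierPartialSum f l x =
      (2 * π : ℂ)⁻¹ * ∫ t in (-π)..π, f t * fejerKernel N (x - t) := by
  simp only [fourierPartialSum_eq_integral hf, ofReal_fejerKernel, Finset.mul_sum]
  rw [intervalIntegral.integral_finsetSum, Finset.mul_sum]
  intro l _
  exact hf.mul_continuousOn
    ((continuous_dirichletKernel l).comp (continuous_const.sub continuous_id)).continuousOn

/-! ### L¹ bounds for sums of partial sums. -/

theorem l1Norm_nonneg (f : ℝ → ℂ) : 0 ≤ l1Norm f :=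
  intervalIntegral.integral_nonneg (by linarith [pi_pos]) fun _ _ => norm_nonneg _

/-- The sums of the first `N` partial sums have norm at most `N` on `L¹`. -/
theorem l1Norm_sum_fourierPartialSum_le {f : ℝ → ℂ} (hf : IntervalIntegrable f volume (-π) π)
    (N : ℕ) :
    l1Norm (fun x => ∑ l ∈ Finset.range N, fourierPartialSum f l x) ≤ N * l1Norm f := by
  have hπ : -π ≤ π := by linarith [pi_pos]
  have hcont := continuous_fejerKernel N
  set μ := (volume : Measure ℝ).restrict (Set.Ioc (-π) π) with hμ
  have hfi : Integrable f μ := (intervalIntegrable_iff_integrableOn_Ioc_of_le hπ).1 hf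
  have hint : Integrable (Function.uncurry fun x t : ℝ => ‖f t‖ * fejerKernel N (x - t))
      (μ.prod μ) := by
    refine (hfi.norm.comp_snd μ).mul_bdd (c := (N : ℝ) ^ 2) ?_ (Filter.Eventually.of_forall ?_)
    · exact (hcont.comp (continuous_fst.sub continuous_snd)).aestronglyMeasurable
    · rintro ⟨x, t⟩
      rw [Real.norm_of_nonneg (fejerKernel_nonneg _ _)]
      unfold fejerKernel
      gcongr
      refine (norm_sum_le _ _).trans ?_
      have : ∀ y : ℝ, ‖Complex.exp (Complex.I * y)‖ = 1 := fun y => by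
        rw [mul_comm]; exact Complex.norm_exp_ofReal_mul_I y
      simp only [norm_pow, this]
      simp
  have hpt : ∀ x, ‖∑ l ∈ Finset.range N, fourierPartialSum f l x‖ ≤
      (2 * π)⁻¹ * ∫ t, ‖f t‖ * fejerKernel N (x - t) ∂μ := by
    intro x
    rw [sum_fourierPartialSum_eq_integral hf, norm_mul, intervalIntegral.integral_of_le hπ]
    have : ‖(2 * π : ℂ)⁻¹‖ = (2 * π)⁻¹ := by
      rw [norm_inv, norm_mul]
      simp [abs_of_pos pi_pos]
    rw [this]
    gcongr
    refine (MeasureTheory.norm_integral_le_integral_norm _).trans (le_of_eq ?_)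
    refine integral_congr_ae (Filter.Eventually.of_forall fun t => ?_)
    simp [abs_of_nonneg (fejerKernel_nonneg _ _)]
  unfold l1Norm
  rw [intervalIntegral.integral_of_le hπ, intervalIntegral.integral_of_le hπ]
  -- Fubini: the kernel is nonnegative, so integrating in x leaves its total mass 2πN for every t.
  calc ∫ x, ‖∑ l ∈ Finset.range N, fourierPartialSum f l x‖ ∂μ
      ≤ ∫ x, (2 * π)⁻¹ * ∫ t, ‖f t‖ * fejerKernel N (x - t) ∂μ ∂μ := by
        refine integral_mono_of_nonneg (Filter.Eventually.of_forall fun _ => norm_nonneg _)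
          (hint.integral_prod_left.const_mul _) (Filter.Eventually.of_forall hpt)
    _ = (2 * π)⁻¹ * ∫ t, ∫ x, ‖f t‖ * fejerKernel N (x - t) ∂μ ∂μ := by
        rw [MeasureTheory.integral_const_mul, integral_integral_swap hint]
    _ = (2 * π)⁻¹ * ∫ t, ‖f t‖ * (N * (2 * π)) ∂μ := by
        congr 1
        refine integral_congr_ae (Filter.Eventually.of_forall fun t => ?_)
        simp only
        rw [MeasureTheory.integral_const_mul, hμ, ← intervalIntegral.integral_of_le hπ,
          integral_fejerKernel_sub]
    _ = N * ∫ t, ‖f t‖ ∂μ := by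
        rw [MeasureTheory.integral_mul_const]
        have := two_pi_pos.ne'
        field_simp

theorem l1Norm_add_le {f g : ℝ → ℂ} (hf : IntervalIntegrable f volume (-π) π)
    (hg : IntervalIntegrable g volume (-π) π) :
    l1Norm (fun x => f x + g x) ≤ l1Norm f + l1Norm g := by
  unfold l1Norm
  rw [← integral_add hf.norm hg.norm]
  exact integral_mono_on (by linarith [pi_pos]) (hf.add hg).norm (hf.norm.add hg.norm)
    fun x _ => norm_add_le _ _

theorem l1Norm_neg (f : ℝ → ℂ) : l1Norm (fun x => -f x) = l1Norm f := by
  simp [l1Norm]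

theorem l1Norm_sub_le {f g : ℝ → ℂ} (hf : IntervalIntegrable f volume (-π) π)
    (hg : IntervalIntegrable g volume (-π) π) :
    l1Norm (fun x => f x - g x) ≤ l1Norm f + l1Norm g := by
  have h := l1Norm_add_le hf hg.neg
  rw [show l1Norm (-g) = l1Norm g from l1Norm_neg g] at h
  simpa [sub_eq_add_neg] using h

theorem l1Norm_const_mul (c : ℂ) (f : ℝ → ℂ) : l1Norm (fun x => c * f x) = ‖c‖ * l1Norm f := by
  simp [l1Norm]

/-! ### Density of trigonometric polynomials and delayed means. -/

/-- Orthogonality reproduces the character of index j once l ≥ |j|; linear combinations inherit a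
common threshold. -/
theorem fourierPartialSum_fourier_span {P : C(AddCircle (2 * π), ℂ)}
    (hP : P ∈ Submodule.span ℂ (Set.range (@fourier (2 * π)))) :
    ∃ n₀ : ℕ, ∀ l ≥ n₀, ∀ x : ℝ, fourierPartialSum (fun t => P (t : AddCircle (2 * π))) l x = P x := by
  have hint : ∀ Q : C(AddCircle (2 * π), ℂ), IntervalIntegrable
      (fun t : ℝ => Q (t : AddCircle (2 * π))) volume (-π) π := fun Q =>
    Continuous.intervalIntegrable (Q.continuous.comp (AddCircle.continuous_mk' _)) _ _
  induction hP using Submodule.span_induction with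
  | mem Q hQ =>
    obtain ⟨j, rfl⟩ := hQ
    have hj : ∀ t : ℝ, fourier j (t : AddCircle (2 * π)) = Complex.exp (Complex.I * j * t) := by
      intro t
      have hπ : (π : ℂ) ≠ 0 := by exact_mod_cast pi_ne_zero
      rw [fourier_coe_apply]
      congr 1
      push_cast
      field_simp
    refine ⟨j.natAbs, fun l hl x => ?_⟩
    simp only [hj, fourierPartialSum, fourierHat_exp, ite_mul, one_mul, zero_mul]
    rw [Finset.sum_ite_eq', if_pos]
    rw [Finset.mem_Icc]
    omega
  | zero => exact ⟨0, fun l _ x => by simp [fourierPartialSum, fourierHat_eq_integral]⟩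
  | add Q R _ _ hQ hR =>
    obtain ⟨a, ha⟩ := hQ
    obtain ⟨b, hb⟩ := hR
    refine ⟨max a b, fun l hl x => ?_⟩
    rw [ContinuousMap.add_apply, ← ha l (le_of_max_le_left hl), ← hb l (le_of_max_le_right hl)]
    simp only [fourierPartialSum, ContinuousMap.add_apply, fourierHat_add (hint Q) (hint R),
      add_mul, Finset.sum_add_distrib]
  | smul c Q _ hQ =>
    obtain ⟨a, ha⟩ := hQ
    refine ⟨a, fun l hl x => ?_⟩
    rw [ContinuousMap.smul_apply, ← ha l hl]
    simp only [fourierPartialSum, ContinuousMap.smul_apply, smul_eq_mul, fourierHat_const_mul,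
      Finset.mul_sum, mul_assoc]

/-- Trigonometric polynomials are dense in `L¹` of a period. -/
theorem exists_fourierPartialSum_eq_l1Norm_sub_lt {f : ℝ → ℂ}
    (hf : IntervalIntegrable f volume (-π) π) {ε : ℝ} (hε : 0 < ε) :
    ∃ P : ℝ → ℂ, Continuous P ∧ (∃ n₀ : ℕ, ∀ l ≥ n₀, ∀ x, fourierPartialSum P l x = P x) ∧
      l1Norm (fun x => f x - P x) < ε := by
  have : Fact (0 < 2 * π) := ⟨two_pi_pos⟩
  have hπ : -π + 2 * π = π := by ring
  have hle : -π ≤ π := by linarith [pi_pos]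
  have hfi : MemLp f 1 (volume.restrict (Set.Ioc (-π) (-π + 2 * π))) := by
    rw [hπ, memLp_one_iff_integrable]
    exact (intervalIntegrable_iff_integrableOn_Ioc_of_le hle).1 hf
  have hF : MemLp (AddCircle.liftIoc (2 * π) (-π) f) 1 (@AddCircle.haarAddCircle (2 * π) _) :=
    hfi.memLp_liftIoc.haarAddCircle
  have hmem : hF.toLp _ ∈ (Submodule.span ℂ
      (Set.range (@fourierLp (2 * π) _ 1 _))).topologicalClosure := by
    rw [span_fourierLp_closure_eq_top ENNReal.one_ne_top]
    trivial
  -- Haar measure on the circle has mass 1, whereas `l1Norm` uses Lebesgue measure of mass 2π.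
  obtain ⟨u, hu, hlt⟩ := Metric.mem_closure_iff.1 hmem (ε / (2 * π)) (by positivity)
  obtain ⟨P, hP, hPu⟩ : ∃ P ∈ Submodule.span ℂ (Set.range (@fourier (2 * π))),
      ContinuousMap.toLp (E := ℂ) 1 AddCircle.haarAddCircle ℂ P = u := by
    have : Set.range (@fourierLp (2 * π) _ 1 _) =
        (ContinuousMap.toLp (E := ℂ) 1 (@AddCircle.haarAddCircle (2 * π) _) ℂ) ''
          Set.range (@fourier (2 * π)) := by
      rw [← Set.range_comp]
      rfl
    rw [SetLike.mem_coe, this] at hu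
    have h := Submodule.map_span
      (ContinuousMap.toLp (E := ℂ) 1 (@AddCircle.haarAddCircle (2 * π) _) ℂ).toLinearMap
      (Set.range (@fourier (2 * π)))
    have hu' := h.symm ▸ hu
    exact hu'
  refine ⟨fun x => P (x : AddCircle (2 * π)), P.continuous.comp (AddCircle.continuous_mk' _),
    fourierPartialSum_fourier_span hP, ?_⟩
  have hnorm : dist (hF.toLp _) u = (2 * π)⁻¹ * l1Norm (fun x => f x - P x) := by
    rw [dist_eq_norm, L1.norm_eq_integral_norm]
    have h1 : ∫ t, ‖(hF.toLp _ - u) t‖ ∂AddCircle.haarAddCircle =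
        ∫ t, ‖AddCircle.liftIoc (2 * π) (-π) f t - P t‖ ∂AddCircle.haarAddCircle := by
      refine integral_congr_ae ?_
      have hPae := ContinuousMap.coeFn_toLp (p := 1) (𝕜 := ℂ)
        (@AddCircle.haarAddCircle (2 * π) _) P
      rw [hPu] at hPae
      filter_upwards [Lp.coeFn_sub (hF.toLp _) u, hF.coeFn_toLp, hPae] with t h1 h2 h3
      rw [h1, Pi.sub_apply, h2, h3]
    rw [h1, AddCircle.integral_haarAddCircle, smul_eq_mul,
      ← AddCircle.intervalIntegral_preimage (2 * π) (-π), hπ, l1Norm]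
    congr 1
    refine intervalIntegral.integral_congr_ae (Filter.Eventually.of_forall fun x hx => ?_)
    rw [Set.uIoc_of_le hle] at hx
    rw [AddCircle.liftIoc_coe_apply (by rwa [hπ])]
  rw [hnorm, inv_mul_eq_div, div_lt_div_iff_of_pos_right two_pi_pos] at hlt
  exact hlt

/-- The delayed means of Fourier partial sums converge in `L¹`. -/
theorem eventually_l1Norm_sub_delayed_mean_le {f : ℝ → ℂ}
    (hf : IntervalIntegrable f volume (-π) π) {ε : ℝ} (hε : 0 < ε) :
    ∀ᶠ n : ℕ in Filter.atTop,
      l1Norm (fun x => n * f x - ∑ l ∈ Finset.Ico n (2 * n), fourierPartialSum f l x) ≤ n * ε := by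
  -- The quarter pays for three terms in g = f - P, of norm at most n‖g‖, 2n‖g‖ and n‖g‖; P itself
  -- cancels because S_l P = P for l ≥ n.
  obtain ⟨P, hPc, ⟨n₀, hP⟩, hlt⟩ := exists_fourierPartialSum_eq_l1Norm_sub_lt hf
    (show 0 < ε / 4 by positivity)
  have hPi : IntervalIntegrable P volume (-π) π := hPc.intervalIntegrable _ _
  set g : ℝ → ℂ := fun x => f x - P x with hg
  have hgi : IntervalIntegrable g volume (-π) π := hf.sub hPi
  filter_upwards [Filter.eventually_ge_atTop n₀] with n hn
  have heq : ∀ x, n * f x - ∑ l ∈ Finset.Ico n (2 * n), fourierPartialSum f l x =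
      (n * g x - ∑ l ∈ Finset.range (2 * n), fourierPartialSum g l x) +
        ∑ l ∈ Finset.range n, fourierPartialSum g l x := by
    intro x
    have h1 : ∑ l ∈ Finset.Ico n (2 * n), fourierPartialSum f l x =
        ∑ l ∈ Finset.Ico n (2 * n), fourierPartialSum g l x + n * P x := by
      have : ∀ l ∈ Finset.Ico n (2 * n),
          fourierPartialSum f l x = fourierPartialSum g l x + P x := by
        intro l hl
        rw [hg, fourierPartialSum_sub hf hPi, hP l (hn.trans (Finset.mem_Ico.1 hl).1)]
        ring
      rw [Finset.sum_congr rfl this, Finset.sum_add_distrib]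
      simp only [Finset.sum_const, Nat.card_Ico, nsmul_eq_mul]
      rw [show 2 * n - n = n by omega]
    rw [h1, Finset.sum_Ico_eq_sub _ (by omega)]
    simp only [hg]
    ring
  simp_rw [heq]
  have hS : ∀ N, IntervalIntegrable (fun x => ∑ l ∈ Finset.range N, fourierPartialSum g l x)
      volume (-π) π := fun N =>
    (continuous_finsetSum _ fun l _ => continuous_fourierPartialSum g l).intervalIntegrable _ _
  have hn0 : (0 : ℝ) ≤ n := n.cast_nonneg
  have e1 := l1Norm_add_le ((hgi.const_mul (n : ℂ)).sub (hS (2 * n))) (hS n)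
  have e2 := l1Norm_sub_le (hgi.const_mul (n : ℂ)) (hS (2 * n))
  have e3 := l1Norm_sum_fourierPartialSum_le hgi (2 * n)
  have e4 := l1Norm_sum_fourierPartialSum_le hgi n
  rw [l1Norm_const_mul, Complex.norm_natCast] at e2
  push_cast at e3
  have e5 : n * l1Norm g ≤ n * (ε / 4) := mul_le_mul_of_nonneg_left hlt.le hn0
  linarith

/-! ### Summation by parts and exponential sums. -/

theorem sum_Ico_mul_eq_by_parts {R : Type*} [CommRing R] (a v : ℕ → R) {m n : ℕ} (hmn : m ≤ n) :
    ∑ k ∈ Finset.Ico m n, a k * v k = a n * ∑ k ∈ Finset.Ico m n, v k +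
      ∑ k ∈ Finset.Ico m n, (a k - a (k + 1)) * ∑ i ∈ Finset.Ico m (k + 1), v i := by
  induction n, hmn using Nat.le_induction with
  | base => simp
  | succ n hn ih =>
    rw [Finset.sum_Ico_succ_top hn, ih, Finset.sum_Ico_succ_top hn (fun k => _ * _),
      Finset.sum_Ico_succ_top hn]
    ring

/-- Abel's inequality for sequences of bounded variation. -/
theorem norm_sum_Ico_mul_le {a v : ℕ → ℂ} {m n : ℕ} (hmn : m ≤ n) {B : ℝ}
    (hB : ∀ l ≤ n, ‖∑ k ∈ Finset.Ico m l, v k‖ ≤ B) :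
    ‖∑ k ∈ Finset.Ico m n, a k * v k‖ ≤
      (‖a n‖ + ∑ k ∈ Finset.Ico m n, ‖a k - a (k + 1)‖) * B := by
  rw [sum_Ico_mul_eq_by_parts a v hmn, add_mul, Finset.sum_mul]
  refine (norm_add_le _ _).trans (add_le_add ?_ ((norm_sum_le _ _).trans
    (Finset.sum_le_sum fun k hk => ?_)))
  · rw [norm_mul]
    exact mul_le_mul_of_nonneg_left (hB n le_rfl) (norm_nonneg _)
  · rw [norm_mul]
    exact mul_le_mul_of_nonneg_left (hB _ (Finset.mem_Ico.1 hk).2) (norm_nonneg _)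

theorem norm_exp_I_mul (x : ℝ) : ‖Complex.exp (Complex.I * x)‖ = 1 := by
  rw [mul_comm]
  exact Complex.norm_exp_ofReal_mul_I x

theorem two_div_pi_mul_abs_le_norm_exp_sub_one {x : ℝ} (hx : |x| ≤ π) :
    2 / π * |x| ≤ ‖Complex.exp (Complex.I * x) - 1‖ := by
  rw [Complex.norm_exp_I_mul_ofReal_sub_one, norm_mul, Real.norm_ofNat, Real.norm_eq_abs]
  have h := Real.mul_abs_le_abs_sin (x := x / 2) (by rw [abs_div, abs_two]; linarith)
  rw [abs_div, abs_two] at h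
  linarith

/-- A geometric sum on the unit circle is at most `π / |x|`. -/
theorem norm_sum_Ico_exp_pow_mul_abs_le {x : ℝ} (hx : |x| ≤ π) (m n : ℕ) :
    ‖∑ k ∈ Finset.Ico m n, Complex.exp (Complex.I * x) ^ k‖ * |x| ≤ π := by
  rcases le_total n m with h | h
  · simp [Finset.Ico_eq_empty_of_le h, pi_pos.le]
  set z := Complex.exp (Complex.I * x) with hz
  have hz1 : ‖z‖ = 1 := norm_exp_I_mul x
  have h1 : ‖∑ k ∈ Finset.Ico m n, z ^ k‖ * ‖z - 1‖ ≤ 2 := by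
    rw [← norm_mul, geom_sum_Ico_mul _ h]
    refine (norm_sub_le _ _).trans ?_
    simp only [norm_pow, hz1, one_pow]
    norm_num
  have h2 := two_div_pi_mul_abs_le_norm_exp_sub_one hx
  have h3 : ‖∑ k ∈ Finset.Ico m n, z ^ k‖ * (2 / π * |x|) ≤ 2 :=
    (mul_le_mul_of_nonneg_left h2 (norm_nonneg _)).trans h1
  have hπ := pi_pos
  calc _ = ‖∑ k ∈ Finset.Ico m n, z ^ k‖ * (2 / π * |x|) * (π / 2) := by field_simp
    _ ≤ 2 * (π / 2) := by gcongr
    _ = π := by ring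

theorem norm_sum_Ico_exp_pow_le (x : ℝ) (m n : ℕ) :
    ‖∑ k ∈ Finset.Ico m n, Complex.exp (Complex.I * x) ^ k‖ ≤ (n - m : ℕ) := by
  refine (norm_sum_le _ _).trans ?_
  simp

/-- The harmonic mean of the two bounds for a geometric sum on the unit circle. -/
theorem norm_sum_Ico_exp_pow_le_div {x : ℝ} (hx : |x| ≤ π) {m n N : ℕ} (h : n - m ≤ N) :
    ‖∑ k ∈ Finset.Ico m n, Complex.exp (Complex.I * x) ^ k‖ ≤ 2 * π * N / (N * |x| + π) := by
  have h1 := norm_sum_Ico_exp_pow_mul_abs_le hx m n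
  have h2 : ‖∑ k ∈ Finset.Ico m n, Complex.exp (Complex.I * x) ^ k‖ ≤ N :=
    (norm_sum_Ico_exp_pow_le x m n).trans (by exact_mod_cast h)
  have hπ := pi_pos
  rw [le_div_iff₀ (by positivity)]
  nlinarith [mul_le_mul_of_nonneg_left h1 (Nat.cast_nonneg (α := ℝ) N)]

theorem continuous_kernel_majorant (N : ℕ) :
    Continuous fun x : ℝ => 2 * π * N / (N * |x| + π) := by
  refine Continuous.div (by fun_prop) (by fun_prop) fun x => ?_
  have := pi_pos
  positivity

/-- On [0, π] the majorant has primitive 2π log(Nx + π). This is where the logarithm in the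
sufficiency direction arises. -/
theorem integral_kernel_majorant (N : ℕ) :
    ∫ x in (-π)..π, 2 * π * N / (N * |x| + π) = 4 * π * Real.log (N + 1) := by
  have hπ := pi_pos
  have hc := continuous_kernel_majorant N
  have hpos : ∫ x in (0 : ℝ)..π, 2 * π * N / (N * |x| + π) = 2 * π * Real.log (N + 1) := by
    have h : ∀ x ∈ Set.uIcc 0 π, HasDerivAt (fun x => 2 * π * Real.log (N * x + π))
        (2 * π * N / (N * |x| + π)) x := by
      intro x hx
      rw [Set.uIcc_of_le hπ.le] at hx
      rw [abs_of_nonneg hx.1]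
      have hne : (N : ℝ) * x + π ≠ 0 := by have := hx.1; positivity
      have := ((((hasDerivAt_id' x).const_mul (N : ℝ)).add_const π).log hne).const_mul (2 * π)
      refine this.congr_deriv ?_
      ring
    rw [integral_eq_sub_of_hasDerivAt h (hc.intervalIntegrable _ _)]
    rw [show (N : ℝ) * π + π = (N + 1) * π by ring, Real.log_mul (by positivity) hπ.ne']
    simp
    ring
  have hneg : ∫ x in (-π)..0, 2 * π * N / (N * |x| + π) = 2 * π * Real.log (N + 1) := by
    rw [← hpos, ← neg_zero, ← intervalIntegral.integral_comp_neg]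
    simp
  rw [← integral_add_adjacent_intervals (hc.intervalIntegrable (-π) 0)
    (hc.intervalIntegrable 0 π), hpos, hneg]
  ring

/-- The sums `∑ sin (j x) / j` are uniformly bounded. -/
theorem abs_sum_sin_div_le {x : ℝ} (hx : |x| ≤ π) (n : ℕ) :
    |∑ j ∈ Finset.Ico 1 (n + 1), Real.sin (j * x) / j| ≤ 1 + π := by
  have hπ := pi_pos
  have hsin : ∀ j : ℕ, Real.sin (j * x) = (Complex.exp (Complex.I * x) ^ j).im := by
    intro j
    rw [← Complex.exp_nat_mul, show (j : ℂ) * (Complex.I * x) = ((j * x : ℝ) : ℂ) * Complex.I by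
      push_cast; ring, Complex.exp_ofReal_mul_I_im]
  rcases eq_or_ne x 0 with rfl | hx0
  · simp
    linarith
  have hxp : 0 < |x| := abs_pos.2 hx0
  have hsmall : ∀ K : ℕ, K * |x| ≤ 1 →
      |∑ j ∈ Finset.Ico 1 (K + 1), Real.sin (j * x) / j| ≤ 1 := by
    intro K hK
    refine ((Finset.abs_sum_le_sum_abs _ _).trans (Finset.sum_le_sum fun j hj => ?_)).trans
      (b := ∑ j ∈ Finset.Ico 1 (K + 1), |x|) ?_
    · have hj0 : (0 : ℝ) < j := by exact_mod_cast (Finset.mem_Ico.1 hj).1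
      rw [abs_div, abs_of_pos hj0, div_le_iff₀ hj0]
      refine Real.abs_sin_le_abs.trans ?_
      rw [abs_mul, abs_of_pos hj0, mul_comm]
    · simpa using hK
  -- Below the cut 1/|x| each term is at most |x|; above it Abel's inequality applies, with
  -- geometric sums at most π/|x|.
  set K := ⌊1 / |x|⌋₊ with hK
  have hK1 : K * |x| ≤ 1 := by
    rw [← le_div_iff₀ hxp]
    exact Nat.floor_le (by positivity)
  have hK2 : 1 < (K + 1) * |x| := by
    rw [← div_lt_iff₀ hxp]
    exact Nat.lt_floor_add_one _
  rcases le_total n K with hn | hn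
  · refine (hsmall n ?_).trans (by linarith)
    refine le_trans ?_ hK1
    gcongr
  rw [← Finset.sum_Ico_consecutive _ (Nat.le_add_left 1 K) (Nat.succ_le_succ hn)]
  refine (abs_add_le _ _).trans (add_le_add (hsmall K hK1) ?_)
  have him : ∑ j ∈ Finset.Ico (K + 1) (n + 1), Real.sin (j * x) / j =
      (∑ j ∈ Finset.Ico (K + 1) (n + 1),
        ((1 / j : ℝ) : ℂ) * Complex.exp (Complex.I * x) ^ j).im := by
    rw [Complex.im_sum]
    refine Finset.sum_congr rfl fun j _ => ?_
    rw [Complex.im_ofReal_mul, hsin]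
    ring
  rw [him]
  refine (Complex.abs_im_le_norm _).trans ?_
  have hB : ∀ l ≤ n + 1,
      ‖∑ k ∈ Finset.Ico (K + 1) l, Complex.exp (Complex.I * x) ^ k‖ ≤ π / |x| := fun l _ => by
    rw [le_div_iff₀ hxp]
    exact norm_sum_Ico_exp_pow_mul_abs_le hx _ _
  refine (norm_sum_Ico_mul_le (a := fun j => ((1 / j : ℝ) : ℂ)) (Nat.succ_le_succ hn) hB).trans ?_
  -- The variation of 1/k telescopes, and the end term 1/(n + 1) cancels.
  have hvar : ‖((1 / ((n + 1 : ℕ) : ℝ) : ℝ) : ℂ)‖ + ∑ k ∈ Finset.Ico (K + 1) (n + 1),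
      ‖((1 / (k : ℝ) : ℝ) : ℂ) - ((1 / ((k + 1 : ℕ) : ℝ) : ℝ) : ℂ)‖ = 1 / (K + 1) := by
    have h1 : ∀ k ∈ Finset.Ico (K + 1) (n + 1),
        ‖((1 / (k : ℝ) : ℝ) : ℂ) - ((1 / ((k + 1 : ℕ) : ℝ) : ℝ) : ℂ)‖ =
          -(1 / ((k + 1 : ℕ) : ℝ) - 1 / (k : ℝ)) := by
      intro k hk
      have hk0 : (0 : ℝ) < k := by
        exact_mod_cast (Nat.succ_pos K).trans_le (Finset.mem_Ico.1 hk).1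
      rw [← Complex.ofReal_sub, Complex.norm_real, Real.norm_of_nonneg, neg_sub]
      rw [sub_nonneg]
      push_cast
      gcongr
      linarith
    rw [Finset.sum_congr rfl h1, Finset.sum_neg_distrib,
      Finset.sum_Ico_sub (fun k : ℕ => 1 / (k : ℝ)) (Nat.succ_le_succ hn), Complex.norm_real,
      Real.norm_of_nonneg (by positivity)]
    push_cast
    ring
  rw [hvar, div_mul_div_comm, one_mul, div_le_iff₀ (by positivity)]
  nlinarith

/-! ### Sufficiency: blocks of the Fourier series. -/

theorem fourierPartialSum_add_sub (f : ℝ → ℝ) (n d : ℕ) (x : ℝ) :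
    fourierPartialSum (fun x => (f x : ℂ)) (n + d) x - fourierPartialSum (fun x => (f x : ℂ)) n x =
      ∑ k ∈ Finset.Ico (n + 1) (n + d + 1),
          fourierHat (fun x => (f x : ℂ)) k * Complex.exp (Complex.I * x) ^ k +
        (starRingEnd ℂ) (∑ k ∈ Finset.Ico (n + 1) (n + d + 1),
          fourierHat (fun x => (f x : ℂ)) k * Complex.exp (Complex.I * x) ^ k) := by
  induction d with
  | zero => simp
  | succ d ih =>
    have h1 : ∀ j : ℕ, Complex.exp (Complex.I * ((j : ℤ) + 1 : ℤ) * x) =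
        Complex.exp (Complex.I * x) ^ (j + 1) := by
      intro j
      rw [← Complex.exp_nat_mul]; push_cast; ring_nf
    have h2 : ∀ j : ℕ, Complex.exp (Complex.I * (-((j : ℤ) + 1) : ℤ) * x) =
        (starRingEnd ℂ) (Complex.exp (Complex.I * x) ^ (j + 1)) := by
      intro j
      rw [← Complex.exp_nat_mul, ← Complex.exp_conj]
      simp
      ring_nf
    have hS : fourierPartialSum (fun x => (f x : ℂ)) (n + (d + 1)) x =
        fourierPartialSum (fun x => (f x : ℂ)) (n + d) x +
        (fourierHat (fun x => (f x : ℂ)) ((n + d + 1 : ℕ) : ℤ) *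
            Complex.exp (Complex.I * x) ^ (n + d + 1) +
          (starRingEnd ℂ) (fourierHat (fun x => (f x : ℂ)) ((n + d + 1 : ℕ) : ℤ) *
            Complex.exp (Complex.I * x) ^ (n + d + 1))) := by
      rw [fourierPartialSum, ← add_assoc, sum_Icc_neg_succ, h1, h2, map_mul,
        fourierHat_ofReal_neg, fourierPartialSum]
      push_cast
      rfl
    rw [hS, ← add_assoc, Finset.sum_Ico_succ_top (by omega), map_add]
    linear_combination ih

/-- Abel's inequality applies pointwise, the geometric sums having at most d ≤ n terms. The constant
is 2 for the conjugate pair times the 4π of the integrated majorant. -/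
theorem l1Norm_fourierPartialSum_sub_le (f : ℝ → ℝ) {n d : ℕ} (hd : d ≤ n) :
    l1Norm (fun x => fourierPartialSum (fun x => (f x : ℂ)) (n + d) x -
      fourierPartialSum (fun x => (f x : ℂ)) n x) ≤
    8 * π * Real.log (n + 1) * (‖fourierHat (fun x => (f x : ℂ)) ((n + d + 1 : ℕ) : ℤ)‖ +
      ∑ k ∈ Finset.Ico (n + 1) (n + d + 1), ‖fourierHat (fun x => (f x : ℂ)) (k : ℤ) -
        fourierHat (fun x => (f x : ℂ)) ((k + 1 : ℕ) : ℤ)‖) := by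
  set V := ‖fourierHat (fun x => (f x : ℂ)) ((n + d + 1 : ℕ) : ℤ)‖ +
      ∑ k ∈ Finset.Ico (n + 1) (n + d + 1), ‖fourierHat (fun x => (f x : ℂ)) (k : ℤ) -
        fourierHat (fun x => (f x : ℂ)) ((k + 1 : ℕ) : ℤ)‖ with hV
  have hpt : ∀ x ∈ Set.Icc (-π) π, ‖fourierPartialSum (fun x => (f x : ℂ)) (n + d) x -
      fourierPartialSum (fun x => (f x : ℂ)) n x‖ ≤ 2 * V * (2 * π * n / (n * |x| + π)) := by
    intro x hx
    have h := norm_sum_Ico_mul_le (a := fun k : ℕ => fourierHat (fun x => (f x : ℂ)) k)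
      (v := fun k => Complex.exp (Complex.I * x) ^ k) (m := n + 1) (n := n + d + 1) (by omega)
      (B := 2 * π * n / (n * |x| + π))
      (fun l hl => norm_sum_Ico_exp_pow_le_div (abs_le.2 hx) (by omega))
    rw [fourierPartialSum_add_sub]
    refine (norm_add_le _ _).trans ?_
    rw [RCLike.norm_conj]
    linarith
  refine (integral_mono_on (by linarith [pi_pos]) ?_ ?_ hpt).trans (le_of_eq ?_)
  · exact ((continuous_fourierPartialSum _ _).sub
      (continuous_fourierPartialSum _ _)).norm.intervalIntegrable _ _
  · exact ((continuous_kernel_majorant n).const_mul _).intervalIntegrable _ _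
  · rw [intervalIntegral.integral_const_mul, integral_kernel_majorant]
    ring

theorem IsGBV.exists_bound {c : ℕ → ℂ} (hc : IsGBV c) :
    ∃ N : ℕ, 1 ≤ N ∧ ∃ M : ℝ, 0 < M ∧ ∀ m : ℕ, 1 ≤ m → ∃ i ∈ Finset.Ico m (m + N),
      ∑ n ∈ Finset.Icc m (2 * m), ‖c n - c (n + 1)‖ ≤ M * ‖c i‖ := by
  obtain ⟨-, N, hN, M, hM, h⟩ := hc
  refine ⟨N, hN, M, hM, fun m hm => ?_⟩
  obtain ⟨i, hi, heq⟩ := Finset.exists_mem_eq_sup' (Finset.nonempty_Ico.mpr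
    (Nat.lt_add_of_pos_right (n := m) hN)) (fun n => ‖c n‖)
  exact ⟨i, hi, heq ▸ h m hm⟩

theorem tendsto_l1Norm_of_tendsto_mul_log {f : ℝ → ℝ}
    (hf : IntervalIntegrable (fun x => (f x : ℂ)) volume (-π) π)
    (hGBV : IsGBV (fun n : ℕ => fourierHat (fun x => (f x : ℂ)) (n : ℤ)))
    (hlog : Filter.Tendsto
      (fun n : ℕ => fourierHat (fun x => (f x : ℂ)) (n : ℤ) * (Real.log (n : ℝ) : ℂ))
      Filter.atTop (nhds 0)) :
    Filter.Tendsto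
      (fun n : ℕ => l1Norm (fun x => (f x : ℂ) - fourierPartialSum (fun x => (f x : ℂ)) n x))
      Filter.atTop (nhds 0) := by
  obtain ⟨N, hN, M, hM, hvar⟩ := hGBV.exists_bound
  have hπ := pi_pos
  set c : ℕ → ℂ := fun n => fourierHat (fun x => (f x : ℂ)) (n : ℤ) with hc
  set S := fourierPartialSum (fun x => (f x : ℂ)) with hS
  rw [Metric.tendsto_atTop]
  intro ε hε
  -- Chosen so that 16π(δ + Mδ) = ε/4; the 16 is the 8 of the block estimate doubled by log(n + 1) ≤
  -- 2 log n.
  set δ := ε / (4 * (16 * π * (1 + M))) with hδ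
  have hδ0 : 0 < δ := by positivity
  obtain ⟨K, hK⟩ := Metric.tendsto_atTop.1 hlog δ hδ0
  obtain ⟨L, hL⟩ := Filter.eventually_atTop.1
    (eventually_l1Norm_sub_delayed_mean_le hf (show 0 < ε / 4 by positivity))
  refine ⟨max (max K L) 2, fun n hn => ?_⟩
  have hnK : K ≤ n := by omega
  have hnL : L ≤ n := by omega
  have hn2 : 2 ≤ n := by omega
  have hn0 : (0 : ℝ) < n := by exact_mod_cast (by omega : 0 < n)
  have hlogn : 0 < Real.log n := Real.log_pos (by exact_mod_cast (by omega : 1 < n))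
  have hck : ∀ k, n ≤ k → ‖c k‖ * Real.log n ≤ δ := by
    intro k hk
    have h := (hK k (hnK.trans hk)).le
    have hk0 : Real.log n ≤ Real.log k := Real.log_le_log hn0 (by exact_mod_cast hk)
    rw [dist_zero_right, norm_mul, Complex.norm_real, Real.norm_of_nonneg (hlogn.le.trans hk0)] at h
    exact (mul_le_mul_of_nonneg_left hk0 (norm_nonneg _)).trans h
  have hlog1 : Real.log (n + 1) ≤ 2 * Real.log n := by
    rw [← Real.log_rpow hn0]
    refine Real.log_le_log (by positivity) ?_
    have : (2 : ℝ) ≤ n := by exact_mod_cast hn2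
    rw [Real.rpow_two]
    nlinarith
  have hdiff : ∀ l ∈ Finset.Ico n (2 * n), l1Norm (fun x => S l x - S n x) ≤ ε / 4 := by
    intro l hl
    rw [Finset.mem_Ico] at hl
    obtain ⟨d, rfl⟩ := Nat.exists_eq_add_of_le hl.1
    refine (l1Norm_fourierPartialSum_sub_le f (by omega)).trans ?_
    obtain ⟨i, hi, hsum⟩ := hvar n (by omega)
    have h1 : ∑ k ∈ Finset.Ico (n + 1) (n + d + 1), ‖c k - c (k + 1)‖ ≤ M * ‖c i‖ := by
      refine (Finset.sum_le_sum_of_subset_of_nonneg ?_ fun _ _ _ => norm_nonneg _).trans hsum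
      intro k
      simp only [Finset.mem_Ico, Finset.mem_Icc]
      omega
    calc _ ≤ 8 * π * (2 * Real.log n) * (‖c (n + d + 1)‖ + M * ‖c i‖) := by
            gcongr
      _ = 16 * π * (‖c (n + d + 1)‖ * Real.log n + M * (‖c i‖ * Real.log n)) := by ring
      _ ≤ 16 * π * (δ + M * δ) := by
            gcongr
            · exact hck _ (by omega)
            · exact hck _ (Finset.mem_Ico.1 hi).1
      _ = ε / 4 := by
            rw [hδ]
            field_simp
  have hcont : ∀ l, Continuous (S l) := continuous_fourierPartialSum _
  have hsum : ∀ s : Finset ℕ, (∀ l ∈ s, l1Norm (fun x => S l x - S n x) ≤ ε / 4) →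
      l1Norm (fun x => ∑ l ∈ s, (S l x - S n x)) ≤ s.card * (ε / 4) := by
    intro s
    induction s using Finset.induction_on with
    | empty => simp [l1Norm]
    | insert a s ha ih =>
      intro h
      simp only [Finset.sum_insert ha, Finset.card_insert_of_notMem ha]
      have h1 := l1Norm_add_le (f := fun x => S a x - S n x)
        (g := fun x => ∑ l ∈ s, (S l x - S n x))
        (((hcont a).sub (hcont n)).intervalIntegrable _ _)
        ((continuous_finsetSum _ fun l _ => (hcont l).sub (hcont n)).intervalIntegrable _ _)
      have h2 := h a (Finset.mem_insert_self _ _)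
      have h3 := ih fun l hl => h l (Finset.mem_insert_of_mem hl)
      push_cast
      linarith
  have hA := hL n hnL
  have hB := hsum _ hdiff
  rw [Nat.card_Ico, show 2 * n - n = n by omega] at hB
  have hsplit : ∀ x, (n : ℂ) * ((f x : ℂ) - S n x) =
      ((n : ℂ) * (f x : ℂ) - ∑ l ∈ Finset.Ico n (2 * n), S l x) +
        ∑ l ∈ Finset.Ico n (2 * n), (S l x - S n x) := by
    intro x
    rw [Finset.sum_sub_distrib, Finset.sum_const, Nat.card_Ico, show 2 * n - n = n by omega,
      nsmul_eq_mul]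
    ring
  have htot : n * l1Norm (fun x => (f x : ℂ) - S n x) ≤ n * (ε / 4) + n * (ε / 4) := by
    rw [← Complex.norm_natCast n, ← l1Norm_const_mul, Complex.norm_natCast]
    simp_rw [hsplit]
    refine (l1Norm_add_le ?_ ?_).trans (add_le_add hA hB)
    · exact (hf.const_mul _).sub
        ((continuous_finsetSum _ fun l _ => hcont l).intervalIntegrable _ _)
    · exact (continuous_finsetSum _ fun l _ => (hcont l).sub (hcont n)).intervalIntegrable _ _
  rw [dist_zero_right, Real.norm_of_nonneg (l1Norm_nonneg _)]
  have : l1Norm (fun x => (f x : ℂ) - S n x) ≤ ε / 2 := by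
    refine le_of_mul_le_mul_left (htot.trans (le_of_eq ?_)) hn0
    ring
  linarith

/-! ### Necessity: testing against sine sums. -/

/-- The sum pairs g with -2i e^{-int} ∑ sin(jt)/j, whose modulus is at most 2(1 + π) whatever n and
m are. -/
theorem norm_sum_fourierHat_sub_div_le {g : ℝ → ℂ} (hg : IntervalIntegrable g volume (-π) π)
    (n m : ℕ) :
    ‖∑ j ∈ Finset.Ico 1 (m + 1), (fourierHat g (n + j) - fourierHat g (n - j)) / j‖ ≤
      (1 + π) / π * l1Norm g := by
  have hπ := pi_pos
  have hint : ∀ k : ℤ, IntervalIntegrable (fun t => g t * Complex.exp (-(Complex.I * k * t)))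
      volume (-π) π := intervalIntegrable_mul_exp hg
  have hterm : ∀ j : ℕ, (fourierHat g (n + j) - fourierHat g (n - j)) / j =
      (2 * π : ℂ)⁻¹ * ∫ t in (-π)..π, g t * (Complex.exp (-(Complex.I * n * t)) *
        (-2 * Complex.I * (Real.sin (j * t) / j : ℝ))) := by
    intro j
    rw [fourierHat_eq_integral, fourierHat_eq_integral, ← mul_sub,
      ← intervalIntegral.integral_sub (hint _) (hint _), mul_div_assoc,
      ← intervalIntegral.integral_div]
    congr 1
    refine integral_congr fun t _ => ?_
    have h1 : Complex.exp (-(Complex.I * ((n : ℤ) + (j : ℤ) : ℤ) * t)) =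
        Complex.exp (-(Complex.I * n * t)) * Complex.exp (-(j * t) * Complex.I) := by
      rw [← Complex.exp_add]; push_cast; ring_nf
    have h2 : Complex.exp (-(Complex.I * ((n : ℤ) - (j : ℤ) : ℤ) * t)) =
        Complex.exp (-(Complex.I * n * t)) * Complex.exp ((j * t) * Complex.I) := by
      rw [← Complex.exp_add]; push_cast; ring_nf
    have h3 : ((Real.sin (j * t) / j : ℝ) : ℂ) = Complex.sin (j * t) / j := by push_cast; rfl
    simp only [h1, h2, h3, Complex.sin]
    linear_combination (g t * Complex.exp (-(Complex.I * n * t)) *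
      (Complex.exp (-(j * t) * Complex.I) - Complex.exp ((j * t) * Complex.I)) / j) *
        Complex.I_sq
  have hcont : ∀ j : ℕ, IntervalIntegrable (fun t => g t * (Complex.exp (-(Complex.I * n * t)) *
      (-2 * Complex.I * (Real.sin (j * t) / j : ℝ)))) volume (-π) π :=
    fun j => hg.mul_continuousOn (by fun_prop)
  rw [Finset.sum_congr rfl fun j _ => hterm j, ← Finset.mul_sum,
    ← intervalIntegral.integral_finsetSum fun j _ => hcont j, norm_mul]
  have h2π : ‖(2 * π : ℂ)⁻¹‖ = (2 * π)⁻¹ := by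
    rw [norm_inv, norm_mul]
    simp [abs_of_pos hπ]
  have hbound : ‖∫ t in (-π)..π, ∑ j ∈ Finset.Ico 1 (m + 1),
      g t * (Complex.exp (-(Complex.I * n * t)) *
        (-2 * Complex.I * (Real.sin (j * t) / j : ℝ)))‖ ≤ 2 * (1 + π) * l1Norm g := by
    rw [l1Norm, ← intervalIntegral.integral_const_mul]
    refine norm_integral_le_of_norm_le (by linarith)
      (Filter.Eventually.of_forall fun t ht => ?_) (hg.norm.const_mul _)
    rw [← Finset.mul_sum, ← Finset.mul_sum, ← Finset.mul_sum, ← Complex.ofReal_sum, norm_mul,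
      norm_mul, norm_mul, Complex.norm_real, Real.norm_eq_abs]
    have h1 : ‖Complex.exp (-(Complex.I * n * t))‖ = 1 := by
      have := norm_exp_I_mul (-(n * t))
      rw [← this]
      push_cast
      ring_nf
    have h2 := abs_sum_sin_div_le (abs_le.2 ⟨ht.1.le, ht.2⟩) m
    have h3 : ‖(-2 * Complex.I : ℂ)‖ = 2 := by simp
    rw [h1, h3, one_mul]
    nlinarith [norm_nonneg (g t)]
  rw [h2π]
  calc _ ≤ (2 * π)⁻¹ * (2 * (1 + π) * l1Norm g) := by gcongr
    _ = _ := by field_simp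

theorem cos_mul_norm_le_re_of_mem_sector {θ : ℝ} (hθ : θ < π / 2) {z : ℂ} (hz : z ∈ sector θ) :
    Real.cos θ * ‖z‖ ≤ z.re := by
  have hz' : |Complex.arg z| ≤ θ := hz
  rw [← Complex.norm_mul_cos_arg, mul_comm, ← Real.cos_abs (Complex.arg z)]
  refine mul_le_mul_of_nonneg_left ?_ (norm_nonneg _)
  exact Real.cos_le_cos_of_nonneg_of_le_pi (abs_nonneg _) (by linarith [pi_pos]) hz'

/-- For g = f - S_n and 1 ≤ j ≤ n, the coefficient at n - j vanishes and the one at n + j is that of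
f. In the sector, real parts dominate cos θ times moduli. -/
theorem cos_mul_sum_norm_div_le {f : ℝ → ℂ} (hf : IntervalIntegrable f volume (-π) π)
    {θ : ℝ} (hθ : θ < π / 2) (hsec : ∀ n : ℕ, 1 ≤ n → fourierHat f (n : ℤ) ∈ sector θ) (n : ℕ) :
    Real.cos θ * ∑ j ∈ Finset.Ico 1 (n + 1), ‖fourierHat f ((n + j : ℕ) : ℤ)‖ / j ≤
      (1 + π) / π * l1Norm (fun x => f x - fourierPartialSum f n x) := by
  have hSi : IntervalIntegrable (fourierPartialSum f n) volume (-π) π :=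
    (continuous_fourierPartialSum f n).intervalIntegrable _ _
  refine le_trans ?_ (norm_sum_fourierHat_sub_div_le (hf.sub hSi) n n)
  refine le_trans ?_ (Complex.re_le_norm _)
  rw [Complex.re_sum, Finset.mul_sum]
  refine Finset.sum_le_sum fun j hj => ?_
  rw [Finset.mem_Ico] at hj
  have h1 : fourierHat (fun x => f x - fourierPartialSum f n x) (n + j) =
      fourierHat f ((n + j : ℕ) : ℤ) := by
    rw [fourierHat_sub hf hSi, fourierHat_fourierPartialSum, if_neg, sub_zero]
    · push_cast; rfl
    · rw [Finset.mem_Icc]; omega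
  have h2 : fourierHat (fun x => f x - fourierPartialSum f n x) (n - j) = 0 := by
    rw [fourierHat_sub hf hSi, fourierHat_fourierPartialSum, if_pos, sub_self]
    rw [Finset.mem_Icc]; omega
  have h3 : ((fourierHat (fun x => f x - fourierPartialSum f n x) (n + j) -
      fourierHat (fun x => f x - fourierPartialSum f n x) (n - j)) / j).re =
      (fourierHat f ((n + j : ℕ) : ℤ)).re / j := by
    rw [h1, h2, sub_zero, Complex.div_natCast_re]
  refine le_of_le_of_eq ?_ h3.symm
  rw [← mul_div_assoc]
  gcongr
  exact cos_mul_norm_le_re_of_mem_sector hθ (hsec _ (by omega))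

theorem norm_le_norm_add_sum_Ico (c : ℕ → ℂ) {m k : ℕ} (h : m ≤ k) :
    ‖c k‖ ≤ ‖c m‖ + ∑ n ∈ Finset.Ico m k, ‖c n - c (n + 1)‖ := by
  induction k, h using Nat.le_induction with
  | base => simp
  | succ k hk ih =>
    rw [Finset.sum_Ico_succ_top hk]
    have := norm_sub_norm_le (c (k + 1)) (c k)
    rw [norm_sub_rev] at this
    linarith

/-- The variation over [m, 2m] controls c up to index 2m + 1. The window maximum is relaxed to a sum
so that it can later be interchanged with a sum over m. -/
theorem IsGBV.exists_norm_le_sum {c : ℕ → ℂ} (hc : IsGBV c) :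
    ∃ N : ℕ, 1 ≤ N ∧ ∃ M : ℝ, 0 < M ∧ ∀ m k : ℕ, 1 ≤ m → m ≤ k → k ≤ 2 * m + 1 →
      ‖c k‖ ≤ M * ∑ i ∈ Finset.range N, ‖c (m + i)‖ := by
  obtain ⟨N, hN, M, hM, h⟩ := hc.exists_bound
  refine ⟨N, hN, 1 + M, by positivity, fun m k hm hmk hk => ?_⟩
  obtain ⟨i, hi, hsum⟩ := h m hm
  rw [Finset.mem_Ico] at hi
  have hle : ∀ l < N, ‖c (m + l)‖ ≤ ∑ i ∈ Finset.range N, ‖c (m + i)‖ := fun l hl =>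
    Finset.single_le_sum (f := fun i => ‖c (m + i)‖) (fun _ _ => norm_nonneg _)
      (Finset.mem_range.2 hl)
  have h1 := hle 0 (by omega)
  have h2 := hle (i - m) (by omega)
  rw [add_zero] at h1
  rw [show m + (i - m) = i by omega] at h2
  have h3 : ∑ n ∈ Finset.Ico m k, ‖c n - c (n + 1)‖ ≤ M * ‖c i‖ := by
    refine (Finset.sum_le_sum_of_subset_of_nonneg ?_ fun _ _ _ => norm_nonneg _).trans hsum
    intro n
    simp only [Finset.mem_Ico, Finset.mem_Icc]
    omega
  have h4 := norm_le_norm_add_sum_Ico c hmk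
  have h5 := mul_le_mul_of_nonneg_left h2 hM.le
  linarith

/-- For a GBV sequence, `‖c p‖ log p` is controlled by a weighted sum over `(p / 2, p]`. -/
theorem IsGBV.exists_norm_mul_log_le {c : ℕ → ℂ} (hc : IsGBV c) :
    ∃ C : ℝ, 0 < C ∧ ∀ᶠ p : ℕ in Filter.atTop,
      ‖c p‖ * Real.log p ≤ C * ∑ l ∈ Finset.Ico 1 (p / 2 + 1), ‖c (p / 2 + l)‖ / l := by
  obtain ⟨N, hN, M, hM, h⟩ := hc.exists_norm_le_sum
  have hN0 : (0 : ℝ) < N := by exact_mod_cast hN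
  refine ⟨2 * M * N * N, by positivity, ?_⟩
  filter_upwards [Filter.eventually_ge_atTop (4 * N + 8)] with p hp
  obtain ⟨n, hn⟩ : ∃ n, p / 2 = n := ⟨_, rfl⟩
  -- For j ≤ J and i < N the index j + i stays at most n, while J remains large enough that p ≤ (J +
  -- 1)².
  obtain ⟨J, hJ⟩ : ∃ J, n = J + N := ⟨n - N, by omega⟩
  rw [hn]
  set W := ∑ l ∈ Finset.Ico 1 (n + 1), ‖c (n + l)‖ / l with hW
  -- Replacing the weight 1/j by 1/(j + i) costs a factor N, since j + i ≤ Nj.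
  have hinner : ∀ i ∈ Finset.range N,
      ∑ j ∈ Finset.Ico 1 (J + 1), ‖c (n + j + i)‖ / j ≤ N * W := by
    intro i hi
    rw [Finset.mem_range] at hi
    have h1 : ∀ j ∈ Finset.Ico 1 (J + 1),
        ‖c (n + j + i)‖ / j ≤ N * (‖c (n + (j + i))‖ / (j + i : ℕ)) := by
      intro j hj
      rw [Finset.mem_Ico] at hj
      have hj0 : (0 : ℝ) < j := by exact_mod_cast hj.1
      have hji : ((j + i : ℕ) : ℝ) ≤ N * j := by
        have : j + i ≤ N * j := by nlinarith
        exact_mod_cast this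
      have hji0 : (0 : ℝ) < (j + i : ℕ) := by exact_mod_cast (by omega : 0 < j + i)
      rw [← add_assoc n, ← mul_div_assoc, div_le_div_iff₀ hj0 hji0]
      nlinarith [norm_nonneg (c (n + j + i))]
    refine (Finset.sum_le_sum h1).trans ?_
    rw [← Finset.mul_sum, Finset.sum_Ico_add' (fun l => ‖c (n + l)‖ / (l : ℕ)) 1 (J + 1) i]
    refine mul_le_mul_of_nonneg_left ?_ hN0.le
    refine Finset.sum_le_sum_of_subset_of_nonneg ?_ fun _ _ _ => by positivity
    intro l
    simp only [Finset.mem_Ico]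
    omega
  have hharm : Real.log (J + 1 : ℕ) ≤ ∑ j ∈ Finset.Ico 1 (J + 1), (j : ℝ)⁻¹ := by
    have := log_add_one_le_harmonic J
    rw [harmonic_eq_sum_Icc] at this
    push_cast at this
    push_cast
    exact this
  -- The window bound is applied at each m = n + j and averaged with weights 1/j; the second N
  -- counts the shifts i.
  have hmain : ‖c p‖ * ∑ j ∈ Finset.Ico 1 (J + 1), (j : ℝ)⁻¹ ≤ M * (N * (N * W)) := by
    have h1 : ∀ j ∈ Finset.Ico 1 (J + 1), ‖c p‖ * (j : ℝ)⁻¹ ≤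
        M * ∑ i ∈ Finset.range N, ‖c (n + j + i)‖ / j := by
      intro j hj
      rw [Finset.mem_Ico] at hj
      rw [← Finset.sum_div, ← mul_div_assoc, ← div_eq_mul_inv]
      gcongr
      exact h (n + j) p (by omega) (by omega) (by omega)
    rw [Finset.mul_sum]
    refine (Finset.sum_le_sum h1).trans ?_
    rw [← Finset.mul_sum, Finset.sum_comm]
    refine mul_le_mul_of_nonneg_left ((Finset.sum_le_sum hinner).trans ?_) hM.le
    simp
  have hlog : Real.log p ≤ 2 * Real.log (J + 1 : ℕ) := by
    rw [← Real.log_rpow (by positivity), Real.rpow_two]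
    refine Real.log_le_log (by exact_mod_cast (by omega : 0 < p)) ?_
    have : p ≤ (J + 1) ^ 2 := by
      have : p ≤ 4 * J + 1 := by omega
      nlinarith [(by omega : 2 ≤ J)]
    exact_mod_cast this
  calc ‖c p‖ * Real.log p
      ≤ ‖c p‖ * (2 * ∑ j ∈ Finset.Ico 1 (J + 1), (j : ℝ)⁻¹) := by
        gcongr
        linarith
    _ = 2 * (‖c p‖ * ∑ j ∈ Finset.Ico 1 (J + 1), (j : ℝ)⁻¹) := by ring
    _ ≤ 2 * (M * (N * (N * W))) := by gcongr
    _ = 2 * M * N * N * W := by ring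

theorem tendsto_mul_log_of_tendsto_l1Norm {f : ℝ → ℂ}
    (hf : IntervalIntegrable f volume (-π) π)
    (hGBV : IsGBV (fun n : ℕ => fourierHat f (n : ℤ)))
    (hlim : Filter.Tendsto (fun n : ℕ => l1Norm (fun x => f x - fourierPartialSum f n x))
      Filter.atTop (nhds 0)) :
    Filter.Tendsto (fun n : ℕ => fourierHat f (n : ℤ) * (Real.log (n : ℝ) : ℂ))
      Filter.atTop (nhds 0) := by
  obtain ⟨C, hC, hlog⟩ := hGBV.exists_norm_mul_log_le
  obtain ⟨⟨θ, hθ0, hθ, hsec⟩, -⟩ := hGBV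
  have hcos : 0 < Real.cos θ := Real.cos_pos_of_mem_Ioo ⟨by linarith [pi_pos], hθ⟩
  have hlim2 := ((hlim.comp (Nat.tendsto_div_const_atTop two_ne_zero)).const_mul
    (C * ((1 + π) / π / Real.cos θ)))
  rw [mul_zero] at hlim2
  refine squeeze_zero_norm' ?_ hlim2
  filter_upwards [hlog] with p hp
  rw [norm_mul, Complex.norm_real, Real.norm_of_nonneg (Real.log_natCast_nonneg p)]
  refine hp.trans ?_
  rw [mul_assoc]
  refine mul_le_mul_of_nonneg_left ?_ hC.le
  rw [div_mul_eq_mul_div, le_div_iff₀ hcos, mul_comm]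
  exact cos_mul_sum_norm_div_le hf hθ hsec (p / 2)

/-! ### The two-sided limit and the conclusion. -/

/-- The cofinite filter on ℤ expresses |n| → ∞. Since f is real, coefficients at k and -k have equal
modulus, so the negative half adds nothing. -/
theorem tendsto_int_iff_tendsto_nat (f : ℝ → ℝ) :
    Filter.Tendsto
        (fun n : ℕ => fourierHat (fun x => (f x : ℂ)) (n : ℤ) * (Real.log (n : ℝ) : ℂ))
        Filter.atTop (nhds 0) ↔
      Filter.Tendsto
        (fun n : ℤ => fourierHat (fun x => (f x : ℂ)) n * (Real.log |(n : ℝ)| : ℂ))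
        Filter.cofinite (nhds 0) := by
  have hnat : Filter.Tendsto
      (fun n : ℕ => fourierHat (fun x => (f x : ℂ)) (n : ℤ) * (Real.log (n : ℝ) : ℂ))
      Filter.atTop (nhds 0) ↔ Filter.Tendsto
        (fun n : ℤ => fourierHat (fun x => (f x : ℂ)) n * (Real.log |(n : ℝ)| : ℂ))
        Filter.atTop (nhds 0) := by
    rw [← Nat.map_cast_int_atTop, Filter.tendsto_map'_iff]
    simp [Function.comp_def]
  rw [hnat, Int.cofinite_eq, Filter.tendsto_sup]
  refine ⟨fun h => ⟨?_, h⟩, fun h => h.2⟩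
  have h' := tendsto_zero_iff_norm_tendsto_zero.1 h
  refine tendsto_zero_iff_norm_tendsto_zero.2
    ((h'.comp Filter.tendsto_neg_atBot_atTop).congr fun k => ?_)
  simp only [Function.comp_apply, fourierHat_ofReal_neg, norm_mul, RCLike.norm_conj, Int.cast_neg,
    abs_neg]

theorem corollary2 (f : ℝ → ℝ) (hf : MemL2pi (fun x => (f x : ℂ)))
    (hGBV : IsGBV (fun n : ℕ => fourierHat (fun x => (f x : ℂ)) (n : ℤ))) :
    (Filter.Tendsto
        (fun n : ℕ => l1Norm (fun x => (f x : ℂ) - fourierPartialSum (fun x => (f x : ℂ)) n x))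
        Filter.atTop (nhds 0) ↔
      Filter.Tendsto
        (fun n : ℕ => fourierHat (fun x => (f x : ℂ)) (n : ℤ) * (Real.log (n : ℝ) : ℂ))
        Filter.atTop (nhds 0)) ∧
    (Filter.Tendsto
        (fun n : ℕ => l1Norm (fun x => (f x : ℂ) - fourierPartialSum (fun x => (f x : ℂ)) n x))
        Filter.atTop (nhds 0) ↔
      Filter.Tendsto
        (fun n : ℤ => fourierHat (fun x => (f x : ℂ)) n * (Real.log |(n : ℝ)| : ℂ))
        Filter.cofinite (nhds 0)) := by
  have h : Filter.Tendsto
        (fun n : ℕ => l1Norm (fun x => (f x : ℂ) - fourierPartialSum (fun x => (f x : ℂ)) n x))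
        Filter.atTop (nhds 0) ↔
      Filter.Tendsto
        (fun n : ℕ => fourierHat (fun x => (f x : ℂ)) (n : ℤ) * (Real.log (n : ℝ) : ℂ))
        Filter.atTop (nhds 0) :=
    ⟨tendsto_mul_log_of_tendsto_l1Norm hf.2 hGBV, tendsto_l1Norm_of_tendsto_mul_log hf.2 hGBV⟩
  exact ⟨h, h.trans (tendsto_int_iff_tendsto_nat f)⟩
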